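/- A pairwise comparison matrix (PCM) of size $n$ is a real $n\times n$ matrix $A=[a_{ij}]$ with $a_{ij}>0$ and $a_{ij}=1/a_{ji}$ for all $i,j$; it is consistent if $a_{ik}a_{kj}=a_{ij}$ for all $i,j,k$. A PCM $A$ is double perturbed if there is a consistent PCM $B$ such that $A$ and $B$ differ in exactly two off-diagonal elements and their reciprocals, that is, there are indices $i\neq j$ and $k\neq l$ with $\{i,j\}\neq\{k,l\}$ such that $a_{pq}\neq b_{pq}$ holds exactly when $\{p,q\}=\{i,j\}$ or $\{p,q\}=\{k,l\}$. The principal right eigenvector of $A$ is the vector $w$ with positive coordinates, unique up to a positive factor, such that $Aw=\lambda_{\max}w$, where $\lambda_{\max}$ is the principal (Perron) eigenvalue of $A$, i.e. the real eigenvalue that is an upper bound for the moduli of all complex eigenvalues of $A$. A positive vector $w$ is (Pareto) efficient for $A$ if there is no positive vector $w'$ such that $$\left|a_{ij}-\frac{w'_i}{w'_j}\right|\le\left|a_{ij}-\frac{w_i}{w_j}\right|\quad\text{for all } 1\le i,j\le n,$$ with strict inequality for at least one pair $(i,j)$. Theorem. Let $n\ge 4$ and let $A$ be a double perturbed PCM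 of size $n$. Then the principal right eigenvector of $A$ is efficient. -/

import Mathlib

namespace PairwiseComparison

/-- A pairwise comparison matrix: positive entries with `a i j = 1 / a j i`
(so that `a i i = 1`). -/
structure IsPCM {n : ℕ} (A : Matrix (Fin n) (Fin n) ℝ) : Prop where
  pos : ∀ i j, 0 < A i j
  reciprocal : ∀ i j, A i j = 1 / A j i

/-- A consistent pairwise comparison matrix: cardinal transitivity holds. -/
structure IsConsistent {n : ℕ} (A : Matrix (Fin n) (Fin n) ℝ) : Prop where
  isPCM : IsPCM A
  trans : ∀ i j k, A i k * A k j = A i j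

/-- A double perturbed pairwise comparison matrix: it differs from some consistent pairwise
comparison matrix `B` in exactly two off-diagonal elements, at the positions `(i, j)` and
`(k, l)`, and in their reciprocals, at the positions `(j, i)` and `(l, k)`. -/
def IsDoublePerturbed {n : ℕ} (A : Matrix (Fin n) (Fin n) ℝ) : Prop :=
  IsPCM A ∧
    ∃ B : Matrix (Fin n) (Fin n) ℝ, IsConsistent B ∧
      ∃ i j k l : Fin n, i ≠ j ∧ k ≠ l ∧ s(i, j) ≠ s(k, l) ∧
        ∀ p q : Fin n, A p q ≠ B p q ↔ (s(p, q) = s(i, j) ∨ s(p, q) = s(k, l))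

/-- `lam` is the principal (Perron) eigenvalue of the real matrix `A`: it is an eigenvalue,
and it bounds the modulus of every complex eigenvalue. -/
def IsPrincipalEigenvalue {n : ℕ} (A : Matrix (Fin n) (Fin n) ℝ) (lam : ℝ) : Prop :=
  Module.End.HasEigenvalue (Matrix.toLin' A) lam ∧
    ∀ μ : ℂ, Module.End.HasEigenvalue (Matrix.toLin' (A.map Complex.ofReal)) μ → ‖μ‖ ≤ lam

/-- `w` is a principal right (Perron) eigenvector of `A`: a positive vector with
`A w = lam w`, where `lam` is the principal eigenvalue. -/
def IsPrincipalRightEigenvector {n : ℕ} (A : Matrix (Fin n) (Fin n) ℝ) (w : Fin n → ℝ) : Prop :=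
  (∀ i, 0 < w i) ∧ ∃ lam : ℝ, IsPrincipalEigenvalue A lam ∧ A.mulVec w = lam • w

/-- A positive weight vector `w` is (Pareto) efficient for `A` if no other positive weight vector
approximates every entry of `A` at least as well and some entry strictly better. -/
def IsEfficient {n : ℕ} (A : Matrix (Fin n) (Fin n) ℝ) (w : Fin n → ℝ) : Prop :=
  (∀ i, 0 < w i) ∧
    ¬ ∃ w' : Fin n → ℝ, (∀ i, 0 < w' i) ∧
      (∀ i j, |A i j - w' i / w' j| ≤ |A i j - w i / w j|) ∧
      ∃ k l, |A k l - w' k / w' l| < |A k l - w k / w l|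

end PairwiseComparison

/-
After rescaling, `E i j = A i j * w j / w i` is a reciprocal matrix whose rows all have the same
sum `lam`, and the claim becomes that the digraph with arcs `i → j` for `E i j ≤ 1` is strongly
connected: along such an arc, an approximation `w'` at least as good as `w` has
`w' i / w i ≤ w' j / w j`, so strong connectedness makes `w'` proportional to `w`.

The consistent matrix `B` becomes `v i / v j`. Exactly two ordered pairs `(i, j)` are *raised*,
`v i / v j < E i j`. As no row of `E` can dominate another, there is an arc `i → j` as soon as
`(i, j)` is not raised, `i` is not raised from elsewhere and `j` is not raised towards elsewhere.
For two raised pairs that are disjoint or form a path, these arcs already connect the digraph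
strongly. When the two pairs share their first or their second index one more arc is needed; it
comes from `lam` being at least the size of the matrix, by `x + 1 / x ≥ 2`.
-/

namespace PairwiseComparison

variable {ι : Type*}

/-- Strong connectedness of the digraph with arc relation `r`. Loops are irrelevant. -/
def StronglyConnected (r : ι → ι → Prop) : Prop :=
  ∀ i j, Relation.ReflTransGen r i j

theorem stronglyConnected_of_walks {r : ι → ι → Prop} {x y : ι}
    (hyx : Relation.ReflTransGen r y x)
    (h : ∀ p, Relation.ReflTransGen r x p ∧ Relation.ReflTransGen r p y) :
    StronglyConnected r :=
  fun i j ↦ (h i).2.trans (hyx.trans (h j).1)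

theorem exists_ne_ne_ne_of_four_le_card [Fintype ι] (hcard : 4 ≤ Fintype.card ι) (x y z : ι) :
    ∃ u, u ≠ x ∧ u ≠ y ∧ u ≠ z := by
  classical
  obtain ⟨u, -, hu⟩ := Finset.exists_mem_notMem_of_card_lt_card
    (s := {x, y, z}) (t := Finset.univ) (Finset.card_le_three.trans_lt hcard)
  exact ⟨u, by simpa using hu⟩

theorem stronglyConnected_of_fourCycles [Fintype ι] (hcard : 4 ≤ Fintype.card ι)
    {r : ι → ι → Prop} {x y z : ι}
    (hu : ∀ u, u ≠ x → u ≠ y → u ≠ z → r x u ∧ r u y) (hyz : r y z) (hzx : r z x) :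
    StronglyConnected r := by
  obtain ⟨u, hux, huy, huz⟩ := exists_ne_ne_ne_of_four_le_card hcard x y z
  have hxy : Relation.ReflTransGen r x y :=
    .tail (.single (hu u hux huy huz).1) (hu u hux huy huz).2
  refine stronglyConnected_of_walks (.tail (.single hyz) hzx) fun p ↦ ?_
  rcases eq_or_ne p x with rfl | hpx
  · exact ⟨.refl, hxy⟩
  rcases eq_or_ne p y with rfl | hpy
  · exact ⟨hxy, .refl⟩
  rcases eq_or_ne p z with rfl | hpz
  · exact ⟨hxy.tail hyz, hxy.head hzx⟩
  obtain ⟨harc_xp, harc_py⟩ := hu p hpx hpy hpz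
  exact ⟨.single harc_xp, .single harc_py⟩

/-- Positive reciprocal matrices over an arbitrary index type, with reciprocity in the
division-free form `E i j * E j i = 1`. -/
structure IsReciprocal (E : Matrix ι ι ℝ) : Prop where
  pos : ∀ i j, 0 < E i j
  mul_swap : ∀ i j, E i j * E j i = 1

/-- The pair `(i, j)` is raised if the entry of `E` there exceeds that of the consistent matrix
`v i / v j`. For reciprocal `E` a lowered entry is a raised one at the transposed position, so
raised pairs record every perturbation together with its direction. -/
def IsRaised (E : Matrix ι ι ℝ) (v : ι → ℝ) (i j : ι) : Prop :=
  v i / v j < E i j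

namespace IsReciprocal

variable {E : Matrix ι ι ℝ} {v : ι → ℝ} {i j k : ι}

theorem inv_entry (hE : IsReciprocal E) (i j : ι) : (E i j)⁻¹ = E j i :=
  inv_eq_of_mul_eq_one_right (hE.mul_swap i j)

theorem diag (hE : IsReciprocal E) (i : ι) : E i i = 1 := by
  nlinarith [hE.mul_swap i i, hE.pos i i]

theorem swap_le_one_iff (hE : IsReciprocal E) : E j i ≤ 1 ↔ 1 ≤ E i j := by
  rw [← hE.inv_entry, inv_le_one₀ (hE.pos i j)]

theorem two_le_add_swap (hE : IsReciprocal E) (i j : ι) : 2 ≤ E i j + E j i := by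
  nlinarith [hE.mul_swap i j, hE.pos i j, hE.pos j i, sq_nonneg (E i j - E j i)]

theorem isRaised_swap_iff (hE : IsReciprocal E) (hv : ∀ i, 0 < v i) :
    IsRaised E v j i ↔ E i j < v i / v j := by
  rw [IsRaised, ← hE.inv_entry i j, ← inv_div (v i) (v j),
    inv_lt_inv₀ (div_pos (hv i) (hv j)) (hE.pos i j)]

theorem not_isRaised_swap (hE : IsReciprocal E) (hv : ∀ i, 0 < v i) (hij : IsRaised E v i j) :
    ¬IsRaised E v j i :=
  fun hji ↦ lt_asymm hij ((hE.isRaised_swap_iff hv).1 hji)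

theorem ne_of_isRaised (hE : IsReciprocal E) (hv : ∀ i, 0 < v i) (hij : IsRaised E v i j) :
    i ≠ j := by
  rintro rfl
  exact hE.not_isRaised_swap hv hij hij

theorem isRaised_or_isRaised_swap_iff (hE : IsReciprocal E) (hv : ∀ i, 0 < v i) :
    IsRaised E v i j ∨ IsRaised E v j i ↔ E i j ≠ v i / v j := by
  rw [hE.isRaised_swap_iff hv (i := i) (j := j), IsRaised, or_comm, ne_iff_lt_or_gt]

theorem entry_le_entry (hE : IsReciprocal E) (hv : ∀ i, 0 < v i) (hij : v i ≤ v j)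
    (hik : ¬IsRaised E v i k) (hkj : ¬IsRaised E v k j) : E i k ≤ E j k :=
  calc E i k ≤ v i / v k := not_lt.1 hik
    _ ≤ v j / v k := div_le_div_of_nonneg_right hij (hv k).le
    _ ≤ E j k := by rwa [hE.isRaised_swap_iff hv, not_lt] at hkj

end IsReciprocal

/-- Reciprocal matrices with all row sums equal to `lam`: the form taken by a pairwise comparison
matrix after rescaling by a positive eigenvector. -/
structure IsBalanced [Fintype ι] (E : Matrix ι ι ℝ) (lam : ℝ) : Prop extends IsReciprocal E where
  row_sum : ∀ i, ∑ j, E i j = lam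

namespace IsBalanced

variable [Fintype ι] {E : Matrix ι ι ℝ} {v : ι → ℝ} {lam : ℝ}

theorem not_row_lt_row (hE : IsBalanced E lam) (i j : ι) : ¬E i < E j := fun hlt ↦
  (Fintype.sum_strictMono hlt).ne ((hE.row_sum i).trans (hE.row_sum j).symm)

theorem card_le [Nonempty ι] (hE : IsBalanced E lam) : (Fintype.card ι : ℝ) ≤ lam := by
  have hcard : (0 : ℝ) < Fintype.card ι := by exact_mod_cast Fintype.card_pos
  have htotal : ∑ i, ∑ j, E i j = Fintype.card ι * lam := by simp [hE.row_sum]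
  have hpairs : ∑ _i : ι, ∑ _j : ι, (2 : ℝ) ≤ ∑ i, ∑ j, (E i j + E j i) :=
    Finset.sum_le_sum fun i _ ↦ Finset.sum_le_sum fun j _ ↦ hE.two_le_add_swap i j
  simp only [Finset.sum_add_distrib, Finset.sum_comm (f := fun i j ↦ E j i), htotal,
    Finset.sum_const, Finset.card_univ, nsmul_eq_mul] at hpairs
  nlinarith

theorem exists_one_lt (hE : IsBalanced E lam) {i j : ι} (hij : E i j < 1) : ∃ k, 1 < E i k := by
  by_contra! hle
  have : Nonempty ι := ⟨i⟩
  have hsum : ∑ k, E i k < ∑ _k : ι, (1 : ℝ) :=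
    Finset.sum_lt_sum (fun k _ ↦ hle k) ⟨j, Finset.mem_univ j, hij⟩
  rw [hE.row_sum, Finset.sum_const, Finset.card_univ, nsmul_one] at hsum
  exact hsum.not_ge hE.card_le

theorem entry_le_one (hE : IsBalanced E lam) (hv : ∀ i, 0 < v i) {i j : ι}
    (hij : ¬IsRaised E v i j) (hi : ∀ k ≠ j, ¬IsRaised E v k i)
    (hj : ∀ k ≠ i, ¬IsRaised E v j k) : E i j ≤ 1 := by
  by_contra! hlt
  have hvji : v j ≤ v i := (one_le_div (hv j)).1 (hlt.le.trans (not_lt.1 hij))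
  refine hE.not_row_lt_row j i (Pi.lt_def.2 ⟨fun k ↦ ?_, j, by rwa [hE.diag]⟩)
  rcases eq_or_ne k i with rfl | hki
  · rw [hE.diag]
    exact hE.swap_le_one_iff.2 hlt.le
  rcases eq_or_ne k j with rfl | hkj
  · rw [hE.diag]
    exact hlt.le
  exact hE.entry_le_entry hv hvji (hj k hki) (hi k hkj)

theorem entry_lt_one (hE : IsBalanced E lam) (hv : ∀ i, 0 < v i) {i j m : ι}
    (hi : ∀ k, ¬IsRaised E v k i) (hj : ∀ k, ¬IsRaised E v j k) (him : IsRaised E v i m)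
    (hij : ¬IsRaised E v i j) : E i j < 1 := by
  have hvij : v i < v j := by
    by_contra! hvji
    refine hE.not_row_lt_row j i
      (Pi.lt_def.2 ⟨fun k ↦ hE.entry_le_entry hv hvji (hj k) (hi k), m, ?_⟩)
    calc E j m ≤ v j / v m := not_lt.1 (hj m)
      _ ≤ v i / v m := div_le_div_of_nonneg_right hvji (hv m).le
      _ < E i m := him
  exact (not_lt.1 hij).trans_lt ((div_lt_one (hv j)).2 hvij)

theorem stronglyConnected_of_common_fst (hE : IsBalanced E lam) (hv : ∀ i, 0 < v i)
    (hcard : 4 ≤ Fintype.card ι) {a b c : ι}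
    (hR : ∀ p q, IsRaised E v p q ↔ p = a ∧ (q = b ∨ q = c)) :
    StronglyConnected fun i j ↦ E i j ≤ 1 := by
  wlog hvbc : v b ≤ v c generalizing b c
  · exact this (fun p q ↦ by rw [hR, or_comm]) (le_of_not_ge hvbc)
  have hab : a ≠ b := hE.ne_of_isRaised hv (by grind)
  have hac : a ≠ c := hE.ne_of_isRaised hv (by grind)
  have harc_bc : E b c ≤ 1 :=
    (not_lt.1 (by grind : ¬IsRaised E v b c)).trans ((div_le_one (hv c)).2 hvbc)
  have hca_le_ba : E c a ≤ E b a := by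
    by_contra! hlt
    refine hE.not_row_lt_row b c (Pi.lt_def.2 ⟨fun k ↦ ?_, a, hlt⟩)
    rcases eq_or_ne k a with rfl | hka
    · exact hlt.le
    · exact hE.entry_le_entry hv hvbc (by grind) (by grind)
  have harc_ca : E c a ≤ 1 := by
    have hlt_one : ∀ k, k ≠ a → k ≠ b → k ≠ c → E a k < 1 := fun k _ _ _ ↦
      hE.entry_lt_one hv (m := b) (by grind) (by grind) (by grind) (by grind)
    obtain ⟨u, hua, hub, huc⟩ := exists_ne_ne_ne_of_four_le_card hcard a b c
    obtain ⟨k, hk⟩ := hE.exists_one_lt (hlt_one u hua hub huc)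
    have hka : k ≠ a := fun h ↦ hk.ne' (h ▸ hE.diag a)
    obtain rfl | rfl : k = b ∨ k = c := by
      by_contra! hother
      exact hk.not_gt (hlt_one k hka hother.1 hother.2)
    · exact hca_le_ba.trans (hE.swap_le_one_iff.2 hk.le)
    · exact hE.swap_le_one_iff.2 hk.le
  refine stronglyConnected_of_fourCycles hcard (fun u _ _ _ ↦ ⟨?_, ?_⟩) harc_bc harc_ca
  all_goals exact hE.entry_le_one hv (by grind) (by grind) (by grind)

theorem stronglyConnected_of_common_snd (hE : IsBalanced E lam) (hv : ∀ i, 0 < v i)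
    (hcard : 4 ≤ Fintype.card ι) {a b c : ι}
    (hR : ∀ p q, IsRaised E v p q ↔ (p = b ∨ p = c) ∧ q = a) :
    StronglyConnected fun i j ↦ E i j ≤ 1 := by
  wlog hvbc : v b ≤ v c generalizing b c
  · exact this (fun p q ↦ by rw [hR, or_comm]) (le_of_not_ge hvbc)
  have hba : b ≠ a := hE.ne_of_isRaised hv (by grind)
  have hca : c ≠ a := hE.ne_of_isRaised hv (by grind)
  have harc_bc : E b c ≤ 1 :=
    (not_lt.1 (by grind : ¬IsRaised E v b c)).trans ((div_le_one (hv c)).2 hvbc)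
  have harc_ab : E a b ≤ 1 := by
    have hlt_one : ∀ k, k ≠ a → k ≠ b → k ≠ c → E b k < 1 := fun k _ _ _ ↦
      hE.entry_lt_one hv (m := a) (by grind) (by grind) (by grind) (by grind)
    obtain ⟨u, hua, hub, huc⟩ := exists_ne_ne_ne_of_four_le_card hcard a b c
    obtain ⟨k, hk⟩ := hE.exists_one_lt (hlt_one u hua hub huc)
    have hkb : k ≠ b := fun h ↦ hk.ne' (h ▸ hE.diag b)
    have hkc : k ≠ c := fun h ↦ hk.not_ge (h ▸ harc_bc)
    obtain rfl : k = a := by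
      by_contra hka
      exact hk.not_gt (hlt_one k hka hkb hkc)
    exact hE.swap_le_one_iff.2 hk.le
  refine stronglyConnected_of_fourCycles hcard (fun u _ _ _ ↦ ⟨?_, ?_⟩) harc_ab harc_bc
  all_goals exact hE.entry_le_one hv (by grind) (by grind) (by grind)

theorem stronglyConnected_of_path (hE : IsBalanced E lam) (hv : ∀ i, 0 < v i)
    (hcard : 4 ≤ Fintype.card ι) {a b c : ι}
    (hR : ∀ p q, IsRaised E v p q ↔ (p = a ∧ q = b) ∨ (p = b ∧ q = c)) :
    StronglyConnected fun i j ↦ E i j ≤ 1 := by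
  have hbc : b ≠ c := hE.ne_of_isRaised hv (by grind)
  have hasymm : ¬IsRaised E v b a := hE.not_isRaised_swap hv (by grind)
  have harc_cb : E c b ≤ 1 := hE.entry_le_one hv (by grind) (by grind) (by grind)
  have harc_ba : E b a ≤ 1 := hE.entry_le_one hv (by grind) (by grind) (by grind)
  refine stronglyConnected_of_fourCycles hcard (fun u _ _ _ ↦ ⟨?_, ?_⟩) harc_cb harc_ba
  all_goals exact hE.entry_le_one hv (by grind) (by grind) (by grind)

theorem stronglyConnected_of_disjoint (hE : IsBalanced E lam) (hv : ∀ i, 0 < v i)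
    {a b c d : ι} (hac : a ≠ c) (had : a ≠ d) (hbc : b ≠ c) (hbd : b ≠ d)
    (hR : ∀ p q, IsRaised E v p q ↔ (p = a ∧ q = b) ∨ (p = c ∧ q = d)) :
    StronglyConnected fun i j ↦ E i j ≤ 1 := by
  have hab : a ≠ b := hE.ne_of_isRaised hv (by grind)
  have hcd : c ≠ d := hE.ne_of_isRaised hv (by grind)
  have harc : ∀ {p q}, ¬IsRaised E v p q → (∀ k ≠ q, ¬IsRaised E v k p) →
      (∀ k ≠ p, ¬IsRaised E v q k) → Relation.ReflTransGen (fun i j ↦ E i j ≤ 1) p q :=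
    fun hpq hp hq ↦ .single (hE.entry_le_one hv hpq hp hq)
  have hreach_ad := harc (p := a) (q := d) (by grind) (by grind) (by grind)
  have hreach_dc := harc (p := d) (q := c) (by grind) (by grind) (by grind)
  have hreach_cb := harc (p := c) (q := b) (by grind) (by grind) (by grind)
  have hreach_ba := harc (p := b) (q := a) (by grind) (by grind) (by grind)
  have hreach_ac := hreach_ad.trans hreach_dc
  have hreach_db := hreach_dc.trans hreach_cb
  refine stronglyConnected_of_walks hreach_ba fun p ↦ ?_
  rcases eq_or_ne p a with rfl | hpa
  · exact ⟨.refl, hreach_ac.trans hreach_cb⟩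
  rcases eq_or_ne p b with rfl | hpb
  · exact ⟨hreach_ac.trans hreach_cb, .refl⟩
  rcases eq_or_ne p c with rfl | hpc
  · exact ⟨hreach_ac, hreach_cb⟩
  rcases eq_or_ne p d with rfl | hpd
  · exact ⟨hreach_ad, hreach_db⟩
  exact ⟨harc (by grind) (by grind) (by grind), harc (by grind) (by grind) (by grind)⟩

theorem stronglyConnected_of_two_perturbed (hE : IsBalanced E lam) (hv : ∀ i, 0 < v i)
    (hcard : 4 ≤ Fintype.card ι) {i j k l : ι}
    (hdiff : ∀ p q, E p q ≠ v p / v q ↔ s(p, q) = s(i, j) ∨ s(p, q) = s(k, l)) :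
    StronglyConnected fun i j ↦ E i j ≤ 1 := by
  wlog hij : IsRaised E v i j generalizing i j
  · have hji := ((hE.isRaised_or_isRaised_swap_iff hv).2
      ((hdiff i j).2 (.inl rfl))).resolve_left hij
    exact this (fun p q ↦ by rw [hdiff, Sym2.eq_swap (a := i)]) hji
  wlog hkl : IsRaised E v k l generalizing k l
  · have hlk := ((hE.isRaised_or_isRaised_swap_iff hv).2
      ((hdiff k l).2 (.inr rfl))).resolve_left hkl
    exact this (fun p q ↦ by rw [hdiff, Sym2.eq_swap (a := k)]) hlk
  have hR : ∀ p q, IsRaised E v p q ↔ (p = i ∧ q = j) ∨ (p = k ∧ q = l) := by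
    intro p q
    have hji := hE.not_isRaised_swap hv hij
    have hlk := hE.not_isRaised_swap hv hkl
    have hpq : IsRaised E v p q → s(p, q) = s(i, j) ∨ s(p, q) = s(k, l) := fun hpq ↦
      (hdiff p q).1 ((hE.isRaised_or_isRaised_swap_iff hv).1 (.inl hpq))
    simp only [Sym2.eq_iff] at hpq
    grind
  by_cases hik : i = k
  · exact hE.stronglyConnected_of_common_fst hv hcard (a := i) (b := j) (c := l) (by grind)
  by_cases hjl : j = l
  · exact hE.stronglyConnected_of_common_snd hv hcard (a := j) (b := i) (c := k) (by grind)
  by_cases hjk : j = k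
  · exact hE.stronglyConnected_of_path hv hcard (a := i) (b := j) (c := l) (by grind)
  by_cases hil : i = l
  · exact hE.stronglyConnected_of_path hv hcard (a := k) (b := i) (c := j) (by grind)
  exact hE.stronglyConnected_of_disjoint hv hik hil hjk hjl hR

end IsBalanced

/-- The matrix `A i j * w j / w i`, which compares `A` with the ratios `w i / w j`. -/
noncomputable def rescale (A : Matrix ι ι ℝ) (w : ι → ℝ) : Matrix ι ι ℝ :=
  .of fun i j ↦ A i j * w j / w i

theorem rescale_le_one_iff {A : Matrix ι ι ℝ} {w : ι → ℝ} (hw : ∀ i, 0 < w i) {i j : ι} :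
    rescale A w i j ≤ 1 ↔ A i j ≤ w i / w j := by
  rw [rescale, Matrix.of_apply, div_le_one (hw i), le_div_iff₀ (hw j)]

theorem rescale_eq_div_iff {A : Matrix ι ι ℝ} {w v : ι → ℝ} (hw : ∀ i, 0 < w i) {i j : ι} :
    rescale A w i j = v i / w i / (v j / w j) ↔ A i j = v i / v j := by
  have hi := (hw i).ne'
  have hj := (hw j).ne'
  rw [rescale, Matrix.of_apply, div_div_div_eq, mul_comm (w i), ← div_mul_div_comm,
    mul_div_assoc, mul_left_inj' (div_ne_zero hj hi)]

variable {n : ℕ} {A : Matrix (Fin n) (Fin n) ℝ} {w : Fin n → ℝ}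

theorem IsPCM.isBalanced_rescale (hA : IsPCM A) (hw : ∀ i, 0 < w i) {lam : ℝ}
    (heig : A.mulVec w = lam • w) : IsBalanced (rescale A w) lam where
  pos i j := div_pos (mul_pos (hA.pos i j) (hw j)) (hw i)
  mul_swap i j := by
    have hi := (hw i).ne'
    have hj := (hw j).ne'
    have hji := (hA.pos j i).ne'
    simp only [rescale, Matrix.of_apply, hA.reciprocal i j]
    field_simp
  row_sum i := by
    have hi : ∑ j, A i j * w j = lam * w i := congrFun heig i
    simp only [rescale, Matrix.of_apply, ← Finset.sum_div, hi, mul_div_cancel_right₀ _ (hw i).ne']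

theorem IsConsistent.eq_div {B : Matrix (Fin n) (Fin n) ℝ} (hB : IsConsistent B)
    (i j k : Fin n) : B i j = B i k / B j k := by
  rw [eq_div_iff (hB.isPCM.pos j k).ne', hB.trans]

theorem le_of_abs_sub_le_abs_sub {x y z : ℝ} (hxy : x ≤ y) (h : |x - z| ≤ |x - y|) : z ≤ y := by
  rw [abs_of_nonpos (sub_nonpos.2 hxy)] at h
  linarith [neg_le_of_abs_le h]

theorem isEfficient_of_stronglyConnected (hw : ∀ i, 0 < w i)
    (hconn : StronglyConnected fun i j ↦ A i j ≤ w i / w j) : IsEfficient A w := by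
  refine ⟨hw, ?_⟩
  rintro ⟨w', hw', hle, k, l, hlt⟩
  have hmono : ∀ i j, w' i / w i ≤ w' j / w j := fun i j ↦ by
    refine Relation.ReflTransGen.head_induction_on (hconn i j) le_rfl fun {p q} hpq _ hqj ↦ ?_
    have hratio : w' p / w' q ≤ w p / w q := le_of_abs_sub_le_abs_sub hpq (hle p q)
    refine le_trans ?_ hqj
    rw [div_le_div_iff₀ (hw' q) (hw q)] at hratio
    rw [div_le_div_iff₀ (hw p) (hw q)]
    linarith
  have hratio : w' k / w' l = w k / w l := by
    have := (hmono k l).antisymm (hmono l k)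
    rw [div_eq_div_iff (hw k).ne' (hw l).ne'] at this
    rw [div_eq_div_iff (hw' l).ne' (hw l).ne', this, mul_comm]
  exact hlt.ne (by rw [hratio])

end PairwiseComparison

theorem mainTheorem1 (n : ℕ) (hn : 4 ≤ n) (A : Matrix (Fin n) (Fin n) ℝ)
    (hA : PairwiseComparison.IsDoublePerturbed A) (w : Fin n → ℝ)
    (hw : PairwiseComparison.IsPrincipalRightEigenvector A w) :
    PairwiseComparison.IsEfficient A w := by
  obtain ⟨hPCM, B, hB, i, j, k, l, -, -, -, hAB⟩ := hA
  obtain ⟨hw, lam, -, heig⟩ := hw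
  have hE := hPCM.isBalanced_rescale hw heig
  have hv : ∀ p, 0 < B p i / w p := fun p ↦ div_pos (hB.isPCM.pos p i) (hw p)
  have hdiff : ∀ p q, PairwiseComparison.rescale A w p q ≠ B p i / w p / (B q i / w q) ↔
      s(p, q) = s(i, j) ∨ s(p, q) = s(k, l) := fun p q ↦ by
    rw [← hAB, hB.eq_div p q i, ne_eq, PairwiseComparison.rescale_eq_div_iff (v := (B · i)) hw]
  have hconn := hE.stronglyConnected_of_two_perturbed hv (by simpa using hn) hdiff
  refine PairwiseComparison.isEfficient_of_stronglyConnected hw fun p q ↦ ?_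
  exact Relation.ReflTransGen.mono
    (fun _ _ ↦ (PairwiseComparison.rescale_le_one_iff hw).1) _ _ (hconn p q)
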